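/- **Lemma (Main embedding lemma).** Notation. Let $(X,d)$ be a finite metric space, $B(x,r)=\{y: d(x,y)<r\}$, and let $\log$ be the natural logarithm. A finite measure $\mu$ on $X$ is *non-degenerate* if $\mu(x)>0$ for all $x\in X$; its aspect ratio is $\Phi(\mu)=\max_{x\in X}\mu(X)/\mu(x)$. For a partition $P$ of $X$, $P(x)$ is the cluster of $P$ containing $x$. Given $\varepsilon:X\times\mathbb Z\to(0,1]$, an *$\varepsilon$-padded decomposition bundle* on $X$ is a function $\beta$ assigning to each $u\in\mathbb Z$ a probability distribution $\beta(u)$ on the set of partitions of $X$ such that every cluster of every partition in the support of $\beta(u)$ has diameter at most $2^u$, and $\Pr_{P\sim\beta(u)}[B(x,\varepsilon(x,u)2^u)\not\subseteq P(x)]\le \frac12$ for all $x\in X$. For distinct $x,y\in X$ put $$\delta_\varepsilon(x,y)=\min\Big\{\varepsilon(x,u):\ u\in\mathbb Z,\ \tfrac{d(x,y)}{32}\le 2^u\le \tfrac{d(x,y)}{2}\Big\},$$ $$V_\mu(x,y)=\max\Big\{\log\frac{\mu(B(x,2d(x,y)))}{\mu(B(x,d(x,y)/512))},\ \log\frac{\mu(B(y,2d(x,y)))}{\mu(B(y,d(x,y)/512))}\Big\}.$$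 Let $c_{00}$ be the space of finitely supported real sequences. Statement. There is a universal constant $C>0$ such that the following holds. Let $X$ be a finite metric space, $\mu$ a non-degenerate measure on $X$, and $\beta$ an $\varepsilon$-padded decomposition bundle on $X$. Then there are a map $\psi:X\to c_{00}$ and positive weights $(w_i)_{i\in\mathbb N}$, both independent of $p$, such that for every $1\le p\le\infty$ the map $\varphi=\varphi_p:X\to c_{00}$ given by $\varphi_p(x)_i=w_i^{1/p}\,\psi(x)_i$ (with $1/\infty=0$) satisfies, for all distinct $x,y\in X$, $$[V_\mu(x,y)]^{1/p}\cdot\min\{\delta_\varepsilon(x,y),\delta_\varepsilon(y,x)\}\ \le\ \frac{\|\varphi_p(x)-\varphi_p(y)\|_p}{d(x,y)}\ \le\ C\,[\log\Phi(\mu)]^{1/p}.$$ -/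

import Mathlib

open scoped ENNReal

namespace MeasuredDescent

noncomputable section

/-- A measure on a finite space is non-degenerate if every point has positive mass. -/
def NonDegenerate {X : Type*} [MeasurableSpace X] (μ : MeasureTheory.Measure X) : Prop :=
  ∀ x : X, 0 < μ {x}

/-- The aspect ratio `Φ(μ) = max_x μ(X) / μ(x)`. -/
def aspectRatio {X : Type*} [MeasurableSpace X] (μ : MeasureTheory.Measure X) : ℝ :=
  ⨆ x : X, μ.real Set.univ / μ.real {x}

/-- The cluster `P(x)` of the partition `P` that contains `x`.  Partitions of `X` are given by
their equivalence relations; the clusters of `P` are the members of `P.classes`. -/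
def cluster {X : Type*} (P : Setoid X) (x : X) : Set X := {y | P y x}

/-- `D`, a probability distribution over the partitions of `X`, is a `Δ`-bounded `ε`-padded
decomposition. -/
structure IsPaddedDecomposition {X : Type*} [MetricSpace X] (Δ : ℝ) (ε : X → ℝ)
    (D : PMF (Setoid X)) : Prop where
  diam_le : ∀ P ∈ D.support, ∀ C ∈ P.classes, Metric.diam C ≤ Δ
  padded : ∀ x : X,
    D.toOuterMeasure {P | ¬ Metric.ball x (ε x * Δ) ⊆ cluster P x} ≤ 1 / 2

/-- `β` is an `ε`-padded decomposition bundle, where `ε : X × ℤ → (0, 1]`. -/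
structure IsDecompositionBundle {X : Type*} [MetricSpace X] (ε : X → ℤ → ℝ)
    (β : ℤ → PMF (Setoid X)) : Prop where
  mem_Ioc : ∀ x u, ε x u ∈ Set.Ioc (0 : ℝ) 1
  isPadded : ∀ u : ℤ, IsPaddedDecomposition ((2 : ℝ) ^ u) (fun x => ε x u) (β u)

/-- `δ_ε(x, y) = min {ε(x, u) : u ∈ ℤ, d(x, y) / 32 ≤ 2 ^ u ≤ d(x, y) / 2}`; for `x ≠ y` this is
the minimum of a finite nonempty set. -/
def delta {X : Type*} [MetricSpace X] (ε : X → ℤ → ℝ) (x y : X) : ℝ :=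
  sInf {e : ℝ | ∃ u : ℤ, dist x y / 32 ≤ (2 : ℝ) ^ u ∧ (2 : ℝ) ^ u ≤ dist x y / 2 ∧ e = ε x u}

/-- The local volume growth `V_μ(x, y)`. -/
def volGrowth {X : Type*} [MetricSpace X] [MeasurableSpace X] (μ : MeasureTheory.Measure X)
    (x y : X) : ℝ :=
  max
    (Real.log (μ.real (Metric.ball x (2 * dist x y)) / μ.real (Metric.ball x (dist x y / 512))))
    (Real.log (μ.real (Metric.ball y (2 * dist x y)) / μ.real (Metric.ball y (dist x y / 512))))

/-- A finitely supported sequence lies in `ℓ_p`. -/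
theorem memℓp_coe (p : ℝ≥0∞) (v : ℕ →₀ ℝ) : Memℓp (fun i => v i) p :=
  (memℓp_zero v.hasFiniteSupport).of_exponent_ge bot_le

/-- The `ℓ_p` norm of `v ∈ c_00`, the space of finitely supported real sequences. -/
def normP (p : ℝ≥0∞) (v : ℕ →₀ ℝ) : ℝ :=
  ‖(⟨fun i => v i, memℓp_coe p v⟩ : lp (fun _ : ℕ => ℝ) p)‖

end

end MeasuredDescent

/-! This is measured descent. For a level `t` and a point `z`, let `volScale μ z t` be the dyadic
scale at which the ball about `z` reaches mass `2 ^ t`. For a shift `i`, draw independent padded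
partitions at all scales, colour their clusters by fair coins, and let each `z` consult the
partition at its own scale `volScale μ z t + i`. A coordinate is the distance to the set of points
coloured `false`, weighted by the probability of the outcome; it is 1-Lipschitz.

Upper bound: the weights for each `(t, i)` sum to 1, there are `O(log Φ)` useful levels and eleven
shifts, so the total weight is `O(log Φ)`.

Lower bound: about `V` levels `t` lie between the masses of the small and the large ball about `x`
(or `y`). For each, the scale at `x` is comparable to `d(x, y)`, some shift brings it just below
`d(x, y)`, and nearby points use the same scale up to 1 (`volScale_spec`). With constant probability
all partitions concerned are padded at `x` with colour `true`, while `y` has colour `false`; then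
the coordinate vanishes at `y` and is of order `δ d(x, y)` at `x` (`pow_le_sum_weight`). Putting
weights to the power `1 / p` gives every `ℓ_p` at once (`exists_embedding_of_weights`). -/

open scoped ENNReal
open MeasureTheory

namespace MeasuredDescent

/-! ### Product probabilities and coloured random partitions -/

/-- A lower bound for the probability of a product event that constrains only the coordinates
in `F`. -/
theorem pow_card_le_sum_prod {ι α : Type*} [Fintype ι] [DecidableEq ι] [Fintype α]
    {q : ι → α → ℝ} (hs : ∀ i, ∑ a, q i a = 1) (A : ι → α → Prop)
    [∀ i, DecidablePred (A i)] (F : Finset ι) {c : ℝ} (hc : 0 ≤ c)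
    (hF : ∀ i ∉ F, ∀ a, A i a) (hA : ∀ i ∈ F, c ≤ ∑ a with A i a, q i a) :
    c ^ F.card ≤ ∑ ω : ι → α with ∀ i, A i (ω i), ∏ i, q i (ω i) := by
  have h1 : ∑ ω : ι → α with ∀ i, A i (ω i), ∏ i, q i (ω i)
      = ∏ i, ∑ a with A i a, q i a := by
    rw [Finset.prod_univ_sum]
    congr 1
    ext ω
    simp [Fintype.mem_piFinset]
  have h2 : ∏ i, ∑ a with A i a, q i a = ∏ i ∈ F, ∑ a with A i a, q i a := by
    symm
    refine Finset.prod_subset (Finset.subset_univ F) fun i _ hi => ?_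
    rw [Finset.filter_true_of_mem fun a _ => hF i hi a, hs]
  rw [h1, h2, ← Finset.prod_const]
  exact Finset.prod_le_prod (fun _ _ => hc) hA

/-- Independent fair coins take prescribed values at two places with probability at least
`1 / 4`. -/
theorem quarter_le_sum_coin {B : Type*} [Fintype B] [DecidableEq B] (a b : B) (p r : Prop)
    [Decidable p] [Decidable r] (h : p → r → a ≠ b) :
    (1 / 4 : ℝ) ≤ ∑ σ : B → Bool with (p → σ a = true) ∧ (r → σ b = false),
      ∏ _i : B, (1 / 2 : ℝ) := by
  have key := pow_card_le_sum_prod (ι := B) (α := Bool) (q := fun _ _ => (1 / 2 : ℝ))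
    (fun i => by simp) (fun i v => (p → i = a → v = true) ∧ (r → i = b → v = false)) {a, b}
    (c := 1 / 2) (by norm_num) (by
      intro i hi v
      simp only [Finset.mem_insert, Finset.mem_singleton, not_or] at hi
      exact ⟨fun _ h => absurd h hi.1, fun _ h => absurd h hi.2⟩) (by
      intro i _
      obtain ⟨v, hv⟩ : ∃ v : Bool, (p → i = a → v = true) ∧ (r → i = b → v = false) := by
        by_cases h1 : p ∧ i = a
        · refine ⟨true, fun _ _ => rfl, fun hr hib => ?_⟩
          exact absurd (h1.2.symm.trans hib) (h h1.1 hr)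
        · exact ⟨false, fun hp hi => absurd ⟨hp, hi⟩ h1, fun _ _ => rfl⟩
      exact Finset.single_le_sum (f := fun _ : Bool => (1 / 2 : ℝ))
        (fun _ _ => by norm_num) (Finset.mem_filter.2 ⟨Finset.mem_univ v, hv⟩))
  have hcard : ({a, b} : Finset B).card ≤ 2 := Finset.card_le_two
  refine le_trans ?_ (key.trans (le_of_eq ?_))
  · calc (1 / 4 : ℝ) = (1 / 2) ^ 2 := by norm_num
      _ ≤ _ := pow_le_pow_of_le_one (by norm_num) (by norm_num) hcard
  · congr 1
    ext σ
    simp only [Finset.mem_filter, Finset.mem_univ, true_and]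
    refine ⟨fun H => ⟨fun hp => (H a).1 hp rfl, fun hr => (H b).2 hr rfl⟩, ?_⟩
    rintro ⟨h1, h2⟩ i
    exact ⟨fun hp hi => hi ▸ h1 hp, fun hr hi => hi ▸ h2 hr⟩

/-- The probability of a partition together with a fair colouring of the subsets of `X`. -/
noncomputable def scaleWeight {X : Type*} [Fintype (Set X)] (D : PMF (Setoid X))
    (a : Setoid X × (Set X → Bool)) : ℝ :=
  (D a.1).toReal * ∏ _i : Set X, (1 / 2 : ℝ)

theorem scaleWeight_nonneg {X : Type*} [Fintype (Set X)] (D : PMF (Setoid X))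
    (a : Setoid X × (Set X → Bool)) : 0 ≤ scaleWeight D a := by
  unfold scaleWeight
  positivity

theorem sum_toReal_eq_one {α : Type*} [Fintype α] (D : PMF α) : ∑ a, (D a).toReal = 1 := by
  rw [← ENNReal.toReal_sum fun a _ => D.apply_ne_top a, ← tsum_fintype (L := .unconditional α),
    D.tsum_coe, ENNReal.toReal_one]

theorem sum_scaleWeight {X : Type*} [Fintype (Setoid X)] [Fintype (Set X)]
    (D : PMF (Setoid X)) : ∑ a, scaleWeight D a = 1 := by
  have h : ∑ _σ : Set X → Bool, ∏ _i : Set X, (1 / 2 : ℝ) = 1 := by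
    simp
  simp only [scaleWeight, Fintype.sum_prod_type, ← Finset.mul_sum, h, mul_one]
  exact sum_toReal_eq_one D

theorem half_le_sum_of_toOuterMeasure_le {α : Type*} [Fintype α] (D : PMF α) (Q : α → Prop)
    [DecidablePred Q] (h : D.toOuterMeasure {a | ¬ Q a} ≤ 1 / 2) :
    1 / 2 ≤ ∑ a with Q a, (D a).toReal := by
  classical
  have h1 : ∑ a with ¬ Q a, (D a).toReal ≤ 1 / 2 := by
    rw [PMF.toOuterMeasure_apply_fintype] at h
    simp only [Set.indicator_apply, Set.mem_ofPred_eq] at h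
    rw [← Finset.sum_filter] at h
    rw [← ENNReal.toReal_sum fun a _ => D.apply_ne_top a]
    calc _ ≤ (1 / 2 : ℝ≥0∞).toReal := ENNReal.toReal_mono (by simp) h
      _ = 1 / 2 := by simp
  have h2 := Finset.sum_filter_add_sum_filter_not Finset.univ Q fun a => (D a).toReal
  rw [sum_toReal_eq_one] at h2
  linarith

/-- Padding costs a factor 1/2 and the two colours a factor 1/4. The colours do not conflict: when
`p` holds, clusters are too small to contain both points. The propositions `p` and `r` switch the
constraints at `x` and at `y` on or off. -/
theorem eighth_le_sum_scaleWeight {X : Type*} [MetricSpace X] [Finite X] [Fintype (Setoid X)]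
    [Fintype (Set X)] {D : PMF (Setoid X)} {Δ : ℝ} {ε : X → ℝ} (hD : IsPaddedDecomposition Δ ε D)
    (x y : X) (p r : Prop) (h : p → Δ < dist x y)
    [DecidablePred fun a : Setoid X × (Set X → Bool) =>
      (p → Metric.ball x (ε x * Δ) ⊆ cluster a.1 x ∧ a.2 (cluster a.1 x) = true) ∧
        (r → a.2 (cluster a.1 y) = false)] :
    1 / 8 ≤ ∑ a : Setoid X × (Set X → Bool) with
      (p → Metric.ball x (ε x * Δ) ⊆ cluster a.1 x ∧ a.2 (cluster a.1 x) = true) ∧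
        (r → a.2 (cluster a.1 y) = false), scaleWeight D a := by
  classical
  have h1 := half_le_sum_of_toOuterMeasure_le D
    (fun P => Metric.ball x (ε x * Δ) ⊆ cluster P x) (hD.padded x)
  have h2 : ∀ P : Setoid X,
      (if Metric.ball x (ε x * Δ) ⊆ cluster P x then (D P).toReal else 0) * (1 / 4) ≤
        ∑ σ : Set X → Bool,
          if (p → Metric.ball x (ε x * Δ) ⊆ cluster P x ∧ σ (cluster P x) = true) ∧
            (r → σ (cluster P y) = false) then scaleWeight D (P, σ) else 0 := by
    intro P
    have hnn : 0 ≤ ∑ σ : Set X → Bool,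
          if (p → Metric.ball x (ε x * Δ) ⊆ cluster P x ∧ σ (cluster P x) = true) ∧
            (r → σ (cluster P y) = false) then scaleWeight D (P, σ) else 0 :=
      Finset.sum_nonneg fun σ _ => by split_ifs <;> simp [scaleWeight_nonneg]
    by_cases hP : Metric.ball x (ε x * Δ) ⊆ cluster P x
    swap
    · rw [if_neg hP, zero_mul]
      exact hnn
    -- The diameter bound is available only on the support; off it the left side is zero.
    by_cases hsupp : D P = 0
    · rw [if_pos hP, hsupp, ENNReal.toReal_zero, zero_mul]
      exact hnn
    rw [if_pos hP, ← Finset.sum_filter]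
    simp only [scaleWeight]
    rw [← Finset.mul_sum]
    refine mul_le_mul_of_nonneg_left ?_ ENNReal.toReal_nonneg
    have h3 := quarter_le_sum_coin (cluster P x) (cluster P y) p r (by
      intro hp _ heq
      have hdiam := hD.diam_le P ((PMF.mem_support_iff _ _).2 hsupp) {z | P z x}
        (P.mem_classes x)
      have hy : y ∈ cluster P y := P.refl y
      rw [← heq] at hy
      have := Metric.dist_le_diam_of_mem (Set.toFinite {z | P z x}).isBounded
        (show x ∈ {z | P z x} from P.refl x) (show y ∈ {z | P z x} from hy)
      linarith [h hp])
    simpa only [hP, true_and] using h3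
  rw [Finset.sum_filter, Fintype.sum_prod_type]
  refine le_trans ?_ (Finset.sum_le_sum fun P _ => (h2 P).trans (le_of_eq ?_))
  swap
  · refine Finset.sum_congr rfl fun σ _ => ?_
    congr 1
  rw [← Finset.sum_mul, ← Finset.sum_filter]
  linarith

/-! ### From weighted Lipschitz families to `ℓ_p` -/

theorem le_normP_top {J : Type*} (g : J ↪ ℕ) (v : J →₀ ℝ) (j : J) :
    |v j| ≤ normP ∞ (v.embDomain g) := by
  have := lp.norm_apply_le_norm (p := ∞) (by simp)
    (⟨fun i => v.embDomain g i, memℓp_coe ∞ _⟩ : lp (fun _ : ℕ => ℝ) ∞) (g j)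
  simpa [normP] using this

theorem normP_top_le {J : Type*} (g : J ↪ ℕ) (v : J →₀ ℝ) {r : ℝ} (hr : 0 ≤ r)
    (h : ∀ j, |v j| ≤ r) : normP ∞ (v.embDomain g) ≤ r := by
  refine lp.norm_le_of_forall_le hr fun i => ?_
  by_cases hi : i ∈ Set.range g
  · obtain ⟨j, rfl⟩ := hi
    simpa using h j
  · simpa [Finsupp.embDomain_of_notMem_range _ _ _ hi] using hr

theorem normP_embDomain {J : Type*} [Fintype J] {p : ℝ≥0∞} (hp : 0 < p.toReal) (g : J ↪ ℕ)
    (v : J →₀ ℝ) : normP p (v.embDomain g) = (∑ j, |v j| ^ p.toReal) ^ (p⁻¹).toReal := by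
  have h := lp.norm_eq_tsum_rpow hp
    (⟨fun i => v.embDomain g i, memℓp_coe p _⟩ : lp (fun _ : ℕ => ℝ) p)
  unfold normP
  rw [h, ENNReal.toReal_inv, one_div]
  congr 1
  rw [← g.injective.tsum_eq, tsum_fintype]
  · simp
  · intro i hi
    by_contra hn
    exact hi (by simp [Finsupp.embDomain_of_notMem_range _ _ _ hn, hp.ne'])

/-- A weighted family of Lipschitz functions, enough of which separate each pair of points, gives
embeddings into all `ℓ_p` simultaneously. -/
theorem exists_embedding_of_weights {X J : Type*} [MetricSpace X] [Fintype J] (q : J → ℝ)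
    (hq : ∀ j, 0 < q j) (f : X → J → ℝ) (V δ : X → X → ℝ) (L C c : ℝ) (hC : 1 ≤ C)
    (hc : 0 < c) (hc1 : c ≤ 1) (hL : 0 ≤ L)
    (hf : ∀ x y j, |f x j - f y j| ≤ dist x y)
    (hqL : ∑ j, q j ≤ C * L)
    (hV : ∀ x y, x ≠ y → 0 < V x y) (hδ : ∀ x y, x ≠ y → 0 ≤ δ x y)
    (hsep : ∀ x y, x ≠ y → c * V x y ≤
      ∑ j with c * δ x y * dist x y ≤ |f x j - f y j|, q j) :
    ∃ (ψ : X → ℕ →₀ ℝ) (w : ℕ → ℝ), (∀ i, 0 < w i) ∧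
      ∀ p : ℝ≥0∞, 1 ≤ p →
        ∃ φ : X → ℕ →₀ ℝ, (∀ x i, φ x i = w i ^ (p⁻¹).toReal * ψ x i) ∧
          ∀ x y : X, x ≠ y →
            V x y ^ (p⁻¹).toReal * δ x y ≤ normP p (φ x - φ y) / dist x y ∧
            normP p (φ x - φ y) / dist x y ≤ C / c ^ 2 * L ^ (p⁻¹).toReal := by
  classical
  obtain ⟨g⟩ : Nonempty (J ↪ ℕ) :=
    ⟨(Fintype.equivFin J).toEmbedding.trans Fin.valEmbedding⟩
  -- Of the two factors `1 / c`, one cancels the `c` in the separation threshold, the other the loss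
  -- `c ^ (1 / p)` from the mass of separating indices.
  let F (s : ℝ) (x : X) : J →₀ ℝ :=
    Finsupp.equivFunOnFinite.symm fun j => q j ^ s * ((1 / c ^ 2) * f x j)
  have hF (s : ℝ) (x : X) (j : J) : F s x j = q j ^ s * ((1 / c ^ 2) * f x j) := rfl
  have hemb (s : ℝ) (x y : X) :
      (F s x).embDomain g - (F s y).embDomain g = (F s x - F s y).embDomain g := by
    ext i
    by_cases hi : i ∈ Set.range g
    · obtain ⟨j, rfl⟩ := hi
      simp
    · simp [Finsupp.embDomain_of_notMem_range _ _ _ hi]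
  have hdiff (s : ℝ) (x y : X) (j : J) :
      |(F s x - F s y) j| = q j ^ s * ((1 / c ^ 2) * |f x j - f y j|) := by
    rw [Finsupp.sub_apply, hF, hF, ← mul_sub, ← mul_sub, abs_mul, abs_mul,
      abs_of_nonneg (Real.rpow_nonneg (hq j).le s), abs_of_nonneg (by positivity : 0 ≤ 1 / c ^ 2)]
  -- Exponent 0 gives the unweighted `ψ`. Outside the range of `g` it vanishes, and the default
  -- weight 1 only serves positivity.
  refine ⟨fun x => (F 0 x).embDomain g, Function.extend g q 1, fun i => ?_, fun p hp =>
    ⟨fun x => (F (p⁻¹).toReal x).embDomain g, fun x i => ?_, fun x y hxy => ?_⟩⟩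
  · by_cases hi : i ∈ Set.range g
    · obtain ⟨j, rfl⟩ := hi
      rw [g.injective.extend_apply]
      exact hq j
    · rw [Function.extend_apply' _ _ _ hi]
      exact one_pos
  · by_cases hi : i ∈ Set.range g
    · obtain ⟨j, rfl⟩ := hi
      rw [g.injective.extend_apply]
      simp [hF]
    · simp [Finsupp.embDomain_of_notMem_range _ _ _ hi]
  have hd : 0 < dist x y := dist_pos.2 hxy
  rw [hemb, le_div_iff₀ hd, div_le_iff₀ hd]
  rcases eq_or_ne p ∞ with rfl | hpt
  · have hs : ((∞ : ℝ≥0∞)⁻¹).toReal = 0 := by simp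
    rw [hs]
    simp only [Real.rpow_zero, one_mul, mul_one]
    constructor
    -- For `p = ∞` the weights disappear, and a single separating index suffices; positive total
    -- mass provides one.
    · have hpos : 0 < ∑ j with c * δ x y * dist x y ≤ |f x j - f y j|, q j :=
        (mul_pos hc (hV x y hxy)).trans_le (hsep x y hxy)
      obtain ⟨j, hj⟩ : (Finset.univ.filter fun j =>
          c * δ x y * dist x y ≤ |f x j - f y j|).Nonempty := by
        by_contra hne
        rw [Finset.not_nonempty_iff_eq_empty] at hne
        rw [hne] at hpos
        simp at hpos
      refine le_trans ?_ (le_normP_top g _ j)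
      rw [hdiff, Real.rpow_zero, one_mul]
      have h1 := (Finset.mem_filter.1 hj).2
      have h2 : 0 ≤ δ x y * dist x y := mul_nonneg (hδ x y hxy) hd.le
      calc δ x y * dist x y ≤ (1 / c) * (δ x y * dist x y) :=
            le_mul_of_one_le_left h2 ((one_le_div hc).2 hc1)
        _ = (1 / c ^ 2) * (c * δ x y * dist x y) := by field_simp
        _ ≤ _ := by gcongr
    · refine normP_top_le g _ (by positivity) fun j => ?_
      rw [hdiff, Real.rpow_zero, one_mul]
      have := hf x y j
      gcongr
  have hp0 : 0 < p.toReal := ENNReal.toReal_pos (by positivity) hpt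
  have hp1 : 1 ≤ p.toReal := by
    simpa using ENNReal.toReal_mono hpt hp
  rw [normP_embDomain hp0]
  simp only [hdiff]
  set s := (p⁻¹).toReal with hs
  have hs' : s = p.toReal⁻¹ := by rw [hs, ENNReal.toReal_inv]
  have hs0 : 0 < s := by rw [hs']; positivity
  have hs1 : s ≤ 1 := by rw [hs']; exact inv_le_one_of_one_le₀ hp1
  have hps : p.toReal * s = 1 := by rw [hs']; exact mul_inv_cancel₀ hp0.ne'
  have hterm (j : J) : (q j ^ s * ((1 / c ^ 2) * |f x j - f y j|)) ^ p.toReal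
      = q j * ((1 / c ^ 2) * |f x j - f y j|) ^ p.toReal := by
    rw [Real.mul_rpow (Real.rpow_nonneg (hq j).le s) (by positivity), ← Real.rpow_mul (hq j).le,
      mul_comm s, hps, Real.rpow_one]
  simp only [hterm]
  have hroot {A B : ℝ} (hA : 0 ≤ A) (hB : 0 ≤ B) : (A * B ^ p.toReal) ^ s = A ^ s * B := by
    rw [Real.mul_rpow hA (Real.rpow_nonneg hB _), ← Real.rpow_mul hB, hps, Real.rpow_one]
  constructor
  · have hVp := hV x y hxy
    have hδp := hδ x y hxy
    calc V x y ^ s * δ x y * dist x y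
        = (1 / c) * (c * (V x y ^ s * δ x y * dist x y)) := by field_simp
      _ ≤ (1 / c) * (c ^ s * (V x y ^ s * δ x y * dist x y)) := by
          gcongr
          calc c = c ^ (1 : ℝ) := (Real.rpow_one c).symm
            _ ≤ c ^ s := Real.rpow_le_rpow_of_exponent_ge hc hc1 hs1
      _ = (c * V x y) ^ s * ((1 / c ^ 2) * (c * δ x y * dist x y)) := by
          rw [Real.mul_rpow hc.le hVp.le]
          field_simp
      _ = ((c * V x y) * ((1 / c ^ 2) * (c * δ x y * dist x y)) ^ p.toReal) ^ s :=
          (hroot (by positivity) (by positivity)).symm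
      _ ≤ _ := by
          refine Real.rpow_le_rpow (by positivity) ?_ hs0.le
          calc _ ≤ (∑ j with c * δ x y * dist x y ≤ |f x j - f y j|, q j) *
                ((1 / c ^ 2) * (c * δ x y * dist x y)) ^ p.toReal := by
                gcongr
                exact hsep x y hxy
            _ ≤ ∑ j with c * δ x y * dist x y ≤ |f x j - f y j|,
                  q j * ((1 / c ^ 2) * |f x j - f y j|) ^ p.toReal := by
                rw [Finset.sum_mul]
                refine Finset.sum_le_sum fun j hj => ?_
                have h1 := (Finset.mem_filter.1 hj).2
                have := (hq j).le
                gcongr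
            _ ≤ _ := Finset.sum_le_univ_sum_of_nonneg fun j => by
                have := (hq j).le
                positivity
  · calc _ ≤ (C * L * ((1 / c ^ 2) * dist x y) ^ p.toReal) ^ s := by
          refine Real.rpow_le_rpow (Finset.sum_nonneg fun j _ => by
            have := (hq j).le
            positivity) ?_ hs0.le
          calc _ ≤ ∑ j, q j * ((1 / c ^ 2) * dist x y) ^ p.toReal := by
                refine Finset.sum_le_sum fun j _ => ?_
                have := (hq j).le
                have := hf x y j
                gcongr
            _ ≤ _ := by
                rw [← Finset.sum_mul]
                gcongr
      _ = C ^ s * L ^ s * ((1 / c ^ 2) * dist x y) := by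
          rw [hroot (by positivity) (by positivity), Real.mul_rpow (by positivity) hL]
      _ ≤ C * L ^ s * ((1 / c ^ 2) * dist x y) := by
          gcongr
          calc C ^ s ≤ C ^ (1 : ℝ) := Real.rpow_le_rpow_of_exponent_le hC hs1
            _ = C := Real.rpow_one C
      _ = C / c ^ 2 * L ^ s * dist x y := by ring

/-! ### Separation by the random colour set -/

section Separation

variable {X : Type*} {S : Finset ℤ}

/-- The points whose cluster, in the random partition at the scale `s z`, has colour `false`. -/
def colourSet (s : X → S) (ω : S → Setoid X × (Set X → Bool)) : Set X :=
  {z | (ω (s z)).2 (cluster (ω (s z)).1 z) = false}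

/-- The probability of a family of independent coloured partitions at the scales in `S`. -/
noncomputable def weight [Fintype (Set X)] (β : ℤ → PMF (Setoid X))
    (ω : S → Setoid X × (Set X → Bool)) : ℝ :=
  ∏ u : S, scaleWeight (β u) (ω u)

/-- Points within `r` of `x` use only the three scales around `v`. If these are all padded at `x`
with colour `true`, the ball of radius `r` about `x` misses the colour set, which contains `y` as
soon as its own cluster is `false`. The scale of `y` is arbitrary. -/
theorem pow_le_sum_weight [MetricSpace X] [Finite X] [Fintype (Setoid X)] [Fintype (Set X)]
    {ε : X → ℤ → ℝ} {β : ℤ → PMF (Setoid X)} (hβ : IsDecompositionBundle ε β) (s : X → S)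
    (x y : X) {r : ℝ} (v : ℤ) (hs : ∀ z, dist x z < r → |(s z : ℤ) - v| ≤ 1)
    (hv : ∀ u : ℤ, |u - v| ≤ 1 → r ≤ ε x u * 2 ^ u ∧ (2 : ℝ) ^ u < dist x y)
    [DecidablePred fun ω : S → Setoid X × (Set X → Bool) =>
      r ≤ |Metric.infDist x (colourSet s ω) - Metric.infDist y (colourSet s ω)|] :
    (1 / 4096 : ℝ) ≤ ∑ ω : S → Setoid X × (Set X → Bool) with
      r ≤ |Metric.infDist x (colourSet s ω) - Metric.infDist y (colourSet s ω)|,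
        weight β ω := by
  classical
  let A (u : S) (a : Setoid X × (Set X → Bool)) : Prop :=
    (|(u : ℤ) - v| ≤ 1 →
      Metric.ball x (ε x u * 2 ^ (u : ℤ)) ⊆ cluster a.1 x ∧ a.2 (cluster a.1 x) = true) ∧
    (u = s y → a.2 (cluster a.1 y) = false)
  -- Three scales near `v` and the scale of `y`: at most four independent constraints, whence `(1 /
  -- 8) ^ 4 = 1 / 4096`.
  let F : Finset S := (Finset.univ.filter fun u : S => |(u : ℤ) - v| ≤ 1) ∪ {s y}
  have hF : F.card ≤ 4 := by
    refine (Finset.card_union_le _ _).trans ?_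
    have h3 : (Finset.univ.filter fun u : S => |(u : ℤ) - v| ≤ 1).card ≤
        (Finset.Icc (v - 1) (v + 1)).card := by
      refine Finset.card_le_card_of_injOn (fun u => (u : ℤ)) (fun u hu => ?_)
        (fun _ _ _ _ h => Subtype.ext h)
      have := abs_le.1 (Finset.mem_filter.1 hu).2
      simp only [Finset.coe_Icc, Set.mem_Icc]
      omega
    rw [Int.card_Icc] at h3
    simp only [Finset.card_singleton]
    omega
  have key := pow_card_le_sum_prod (q := fun u : S => scaleWeight (β u))
    (fun u => sum_scaleWeight (β u)) A F (c := 1 / 8) (by norm_num) (by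
      intro u hu a
      simp only [F, Finset.mem_union, Finset.mem_filter, Finset.mem_univ, true_and,
        Finset.mem_singleton, not_or] at hu
      exact ⟨fun h => absurd h hu.1, fun h => absurd h hu.2⟩)
    (fun u _ => eighth_le_sum_scaleWeight (hβ.isPadded u) x y (|(u : ℤ) - v| ≤ 1) (u = s y)
      fun hu => (hv u hu).2)
  calc (1 / 4096 : ℝ) = (1 / 8) ^ 4 := by norm_num
    _ ≤ (1 / 8) ^ F.card := pow_le_pow_of_le_one (by norm_num) (by norm_num) hF
    _ ≤ ∑ ω : S → Setoid X × (Set X → Bool) with ∀ u, A u (ω u), weight β ω := key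
    _ ≤ _ := by
      refine Finset.sum_le_sum_of_subset_of_nonneg (fun ω hω => ?_) fun ω _ _ =>
        Finset.prod_nonneg fun _ _ => scaleWeight_nonneg _ _
      have hA := (Finset.mem_filter.1 hω).2
      refine Finset.mem_filter.2 ⟨Finset.mem_univ _, ?_⟩
      have hy : y ∈ colourSet s ω := (hA (s y)).2 rfl
      rw [Metric.infDist_zero_of_mem hy, sub_zero]
      refine le_trans ?_ (le_abs_self _)
      refine (Metric.le_infDist ⟨y, hy⟩).2 fun z hz => ?_
      by_contra! hlt
      have hu := hs z hlt
      have hA' := (hA (s z)).1 hu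
      have hmem : z ∈ cluster (ω (s z)).1 x := by
        refine hA'.1 ?_
        rw [Metric.mem_ball, dist_comm]
        exact hlt.trans_le (hv _ hu).1
      have hzx : (ω (s z)).1 z x := hmem
      have heq : cluster (ω (s z)).1 z = cluster (ω (s z)).1 x := by
        ext t
        exact ⟨fun h => (ω (s z)).1.trans' h hzx,
          fun h => (ω (s z)).1.trans' h ((ω (s z)).1.symm' hzx)⟩
      have hz' : (ω (s z)).2 (cluster (ω (s z)).1 z) = false := hz
      rw [heq, hA'.2] at hz'
      exact Bool.noConfusion hz'

theorem sum_weight [Fintype (Setoid X)] [Fintype (Set X)] (β : ℤ → PMF (Setoid X)) :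
    ∑ ω : S → Setoid X × (Set X → Bool), weight β ω = 1 := by
  have h := Finset.prod_univ_sum (fun _ : S => (Finset.univ : Finset (Setoid X × (Set X → Bool))))
    fun u a => scaleWeight (β u) a
  rw [Fintype.piFinset_univ] at h
  simp only [weight]
  rw [← h]
  exact Finset.prod_eq_one fun u _ => sum_scaleWeight (β u)

theorem weight_nonneg [Fintype (Set X)] (β : ℤ → PMF (Setoid X))
    (ω : S → Setoid X × (Set X → Bool)) : 0 ≤ weight β ω :=
  Finset.prod_nonneg fun _ _ => scaleWeight_nonneg _ _

end Separation

/-! ### Volume growth and dyadic levels -/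

theorem div_le_aspectRatio {X : Type*} [MeasurableSpace X] {μ : Measure X} [Finite X] (x : X) :
    μ.real Set.univ / μ.real {x} ≤ aspectRatio μ :=
  le_ciSup (f := fun x => μ.real Set.univ / μ.real {x}) (Set.finite_range _).bddAbove x

theorem two_le_aspectRatio {X : Type*} [MeasurableSpace X] {μ : Measure X}
    [IsFiniteMeasure μ] [Finite X] [MeasurableSingletonClass X] (hμ : NonDegenerate μ)
    {x y : X} (h : x ≠ y) : 2 ≤ aspectRatio μ := by
  have hpos (z : X) : 0 < μ.real {z} := ENNReal.toReal_pos (hμ z).ne' (measure_ne_top _ _)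
  have hsum : μ.real {x} + μ.real {y} ≤ μ.real Set.univ := by
    rw [← measureReal_union (by simpa using h) (measurableSet_singleton y)]
    exact measureReal_mono (Set.subset_univ _)
  rcases le_total (μ.real {x}) (μ.real {y}) with hle | hle
  · refine le_trans ?_ (div_le_aspectRatio x)
    rw [le_div_iff₀ (hpos x)]
    linarith
  · refine le_trans ?_ (div_le_aspectRatio y)
    rw [le_div_iff₀ (hpos y)]
    linarith

section Volume

variable {X : Type*} [MetricSpace X] [MeasurableSpace X]

/-- The largest dyadic scale at which the ball about `x` has measure less than `2 ^ t`. -/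
noncomputable def volScale (μ : Measure X) (x : X) (t : ℤ) : ℤ :=
  sSup {k : ℤ | μ.real (Metric.ball x (2 ^ k)) < 2 ^ t}

variable {μ : Measure X} [IsFiniteMeasure μ]

theorem measureReal_ball_mono {x y : X} {r r' : ℝ} (h : dist x y + r ≤ r') :
    μ.real (Metric.ball x r) ≤ μ.real (Metric.ball y r') :=
  measureReal_mono (Metric.ball_subset_ball' (by linarith))

/-- One heavy ball caps the set of scales. Without such a cap `sSup` on `ℤ` would be the default 0.
-/
theorem bddAbove_volScale {y : X} {t k : ℤ} (hk : 2 ^ t ≤ μ.real (Metric.ball y (2 ^ k))) :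
    BddAbove {k : ℤ | μ.real (Metric.ball y (2 ^ k)) < 2 ^ t} := by
  refine ⟨k, fun l hl => ?_⟩
  by_contra! hlt
  have h2 : ((2 : ℝ) ^ k) ≤ 2 ^ l := zpow_le_zpow_right₀ (by norm_num) hlt.le
  have : μ.real (Metric.ball y (2 ^ k)) ≤ μ.real (Metric.ball y (2 ^ l)) :=
    measureReal_ball_mono (by simpa using h2)
  have hl' : μ.real (Metric.ball y (2 ^ l)) < 2 ^ t := hl
  linarith

theorem volScale_lt_of_le {y : X} {t k k' : ℤ}
    (hk' : μ.real (Metric.ball y (2 ^ k')) < 2 ^ t)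
    (hk : 2 ^ t ≤ μ.real (Metric.ball y (2 ^ k))) : volScale μ y t < k := by
  have hb := bddAbove_volScale hk
  have hmem : μ.real (Metric.ball y (2 ^ volScale μ y t)) < 2 ^ t :=
    Int.csSup_mem (s := {k : ℤ | μ.real (Metric.ball y (2 ^ k)) < 2 ^ t}) ⟨k', hk'⟩ hb
  by_contra! hlt
  have h2 : ((2 : ℝ) ^ k) ≤ 2 ^ volScale μ y t := zpow_le_zpow_right₀ (by norm_num) hlt
  have : μ.real (Metric.ball y (2 ^ k)) ≤ μ.real (Metric.ball y (2 ^ volScale μ y t)) :=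
    measureReal_ball_mono (by simpa using h2)
  linarith

theorem le_volScale {y : X} {t k k' : ℤ} (hk' : μ.real (Metric.ball y (2 ^ k')) < 2 ^ t)
    (hk : 2 ^ t ≤ μ.real (Metric.ball y (2 ^ k))) : k' ≤ volScale μ y t :=
  le_csSup (bddAbove_volScale hk) hk'

/-- At a point whose ball of radius `a` has measure less than `2 ^ t` and whose ball of radius `b`
does not, the dyadic scale `volScale` is between `a / 2` and `b`; nearby points have almost the same
scale. -/
theorem volScale_spec {x : X} {t : ℤ} {a b : ℝ} (ha : 0 < a)
    (hta : μ.real (Metric.ball x a) < 2 ^ t) (htb : 2 ^ t ≤ μ.real (Metric.ball x b)) :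
    a / 2 < 2 ^ volScale μ x t ∧ 2 ^ volScale μ x t < b ∧
      ∀ z, dist x z ≤ a / 4 → |volScale μ z t - volScale μ x t| ≤ 1 := by
  have h1 : μ.real (Metric.ball x (2 ^ Int.log 2 a)) < 2 ^ t := by
    refine lt_of_le_of_lt (measureReal_ball_mono ?_) hta
    simpa using Int.zpow_log_le_self (b := 2) (by norm_num) ha
  have h2 : (2 : ℝ) ^ t ≤ μ.real (Metric.ball x (2 ^ (Int.log 2 b + 1))) := by
    refine htb.trans (measureReal_ball_mono ?_)
    simpa using (Int.lt_zpow_succ_log_self (b := 2) (by norm_num) b).le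
  set κ := volScale μ x t with hκ
  have hmem : μ.real (Metric.ball x (2 ^ κ)) < 2 ^ t :=
    Int.csSup_mem (s := {k : ℤ | μ.real (Metric.ball x (2 ^ k)) < 2 ^ t}) ⟨_, h1⟩
      (bddAbove_volScale h2)
  have hnot : (2 : ℝ) ^ t ≤ μ.real (Metric.ball x (2 ^ (κ + 1))) := by
    by_contra! hlt
    have := le_volScale hlt h2
    omega
  have hlow : a / 2 < 2 ^ κ := by
    have h3 := le_volScale h1 h2
    have h4 : (2 : ℝ) ^ Int.log 2 a ≤ 2 ^ κ := zpow_le_zpow_right₀ (by norm_num) h3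
    have h5 := Int.lt_zpow_succ_log_self (b := 2) (by norm_num) a
    rw [zpow_add_one₀ (by norm_num)] at h5
    push_cast at h5
    linarith
  refine ⟨hlow, ?_, fun z hz => ?_⟩
  · by_contra! hle
    have : μ.real (Metric.ball x b) ≤ μ.real (Metric.ball x (2 ^ κ)) :=
      measureReal_ball_mono (by simpa using hle)
    linarith
  -- As `a / 4 < 2 ^ κ / 2`, the ball of radius `2 ^ (κ - 1)` about `z` lies in the light ball about
  -- `x`, and the one of radius `2 ^ (κ + 2)` contains the heavy ball.
  · have h6 : μ.real (Metric.ball z (2 ^ (κ - 1))) < 2 ^ t := by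
      refine lt_of_le_of_lt (measureReal_ball_mono ?_) hmem
      rw [zpow_sub_one₀ (by norm_num), dist_comm]
      linarith
    have h7 : (2 : ℝ) ^ t ≤ μ.real (Metric.ball z (2 ^ (κ + 2))) := by
      refine hnot.trans (measureReal_ball_mono ?_)
      rw [zpow_add₀ (by norm_num), zpow_add₀ (by norm_num)]
      norm_num
      linarith
    have h8 := le_volScale h6 h7
    have h9 := volScale_lt_of_le h6 h7
    rw [abs_le]
    omega

/-- The two small balls are disjoint and lie in both large ones, so the lighter small ball has at
most half the mass of the large ball with its centre. This makes `V` large enough to absorb rounding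
when levels are counted. -/
theorem log_two_le_volGrowth [Finite X] [MeasurableSingletonClass X] (hμ : NonDegenerate μ)
    {x y : X} (h : x ≠ y) : Real.log 2 ≤ volGrowth μ x y := by
  have hd := dist_pos.2 h
  have hpos (z : X) : 0 < μ.real (Metric.ball z (dist x y / 512)) := by
    refine lt_of_lt_of_le (ENNReal.toReal_pos (hμ z).ne' (measure_ne_top _ _))
      (measureReal_mono (Set.singleton_subset_iff.2 (Metric.mem_ball_self (by positivity))))
  have hdisj : Disjoint (Metric.ball x (dist x y / 512)) (Metric.ball y (dist x y / 512)) :=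
    Metric.ball_disjoint_ball (by linarith)
  have hsum : μ.real (Metric.ball x (dist x y / 512)) + μ.real (Metric.ball y (dist x y / 512)) =
      μ.real (Metric.ball x (dist x y / 512) ∪ Metric.ball y (dist x y / 512)) :=
    (measureReal_union hdisj (Set.toFinite _).measurableSet).symm
  rcases le_total (μ.real (Metric.ball x (dist x y / 512)))
    (μ.real (Metric.ball y (dist x y / 512))) with hle | hle
  · refine le_max_of_le_left (Real.log_le_log (by norm_num) ?_)
    rw [le_div_iff₀ (hpos x)]
    have : μ.real (Metric.ball x (dist x y / 512) ∪ Metric.ball y (dist x y / 512)) ≤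
        μ.real (Metric.ball x (2 * dist x y)) :=
      measureReal_mono (Set.union_subset (Metric.ball_subset_ball (by linarith))
        (Metric.ball_subset_ball' (by rw [dist_comm y x]; linarith)))
    linarith
  · refine le_max_of_le_right (Real.log_le_log (by norm_num) ?_)
    rw [le_div_iff₀ (hpos y)]
    have : μ.real (Metric.ball x (dist x y / 512) ∪ Metric.ball y (dist x y / 512)) ≤
        μ.real (Metric.ball y (2 * dist x y)) :=
      measureReal_mono (Set.union_subset (Metric.ball_subset_ball' (by linarith))
        (Metric.ball_subset_ball (by linarith)))
    linarith

/-- With `k` levels, `b / a ≤ 2 ^ (k + 1)`; since `k ≥ 1` and `log 2 < 1`, the logarithm is at most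
`2 * k`. -/
theorem half_log_div_le_card {a b : ℝ} (ha : 0 < a) (hb' : 0 < b)
    (h : Real.log 2 ≤ Real.log (b / a)) :
    Real.log (b / a) / 2 ≤ (Finset.Ioc (Int.log 2 a) (Int.log 2 b)).card := by
  have hl2' := Real.log_two_lt_d9
  have hb : 0 < b / a := by positivity
  have hab : 2 ≤ b / a := (Real.log_le_log_iff (by norm_num) hb).1 h
  have h1 := Int.zpow_log_le_self (b := 2) (by norm_num) ha
  have h2 := Int.lt_zpow_succ_log_self (b := 2) (by norm_num) b
  push_cast at h1 h2
  have h3 : Int.log 2 a + 1 ≤ Int.log 2 b := by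
    rw [← Int.zpow_le_iff_le_log (by norm_num) hb', zpow_add_one₀ (by norm_num)]
    rw [le_div_iff₀ ha] at hab
    push_cast
    linarith
  rw [Int.card_Ioc]
  have h4 : b / a ≤ 2 ^ (Int.log 2 b + 1 - Int.log 2 a) := by
    rw [zpow_sub₀ (by norm_num)]
    gcongr
  have h5 := Real.log_le_log hb h4
  rw [Real.log_zpow] at h5
  have h6 : (((Int.log 2 b - Int.log 2 a).toNat : ℤ) : ℝ) =
      (Int.log 2 b - Int.log 2 a : ℝ) := by
    rw [Int.toNat_of_nonneg (by omega)]
    push_cast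
    rfl
  have h7 : (1 : ℝ) ≤ (Int.log 2 b - Int.log 2 a : ℝ) := by
    have : ((Int.log 2 a + 1 : ℤ) : ℝ) ≤ (Int.log 2 b : ℤ) := Int.cast_le.2 h3
    push_cast at this
    linarith
  rw [Int.cast_natCast] at h6
  rw [h6]
  push_cast at h5
  nlinarith

/-- With `k` levels, `2 ^ (k - 1) ≤ M / m`. The extra level is absorbed by `log (M / m) ≥ log 2`,
and `log 2 > 1 / 2` gives the 4. -/
theorem card_Ioc_log_le {m M : ℝ} (hm : 0 < m) (h : 2 ≤ M / m) :
    ((Finset.Ioc (Int.log 2 m) (Int.log 2 M)).card : ℝ) ≤ 4 * Real.log (M / m) := by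
  have hM : 0 < M := by
    rw [le_div_iff₀ hm] at h
    linarith
  have h1 := Int.zpow_log_le_self (b := 2) (by norm_num) hM
  have h2 := Int.lt_zpow_succ_log_self (b := 2) (by norm_num) m
  push_cast at h1 h2
  have hl2 := Real.log_two_gt_d9
  have hl := Real.log_le_log (by norm_num) h
  have h3 : (2 : ℝ) ^ (Int.log 2 M - (Int.log 2 m + 1)) ≤ M / m := by
    rw [zpow_sub₀ (by norm_num)]
    gcongr
  have h4 := Real.log_le_log (by positivity) h3
  rw [Real.log_zpow] at h4
  push_cast at h4
  rw [Int.card_Ioc]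
  rcases le_total 0 (Int.log 2 M - Int.log 2 m) with h0 | h0
  · have h6 : (((Int.log 2 M - Int.log 2 m).toNat : ℤ) : ℝ) =
        (Int.log 2 M - Int.log 2 m : ℝ) := by
      rw [Int.toNat_of_nonneg h0]
      push_cast
      rfl
    rw [Int.cast_natCast] at h6
    rw [h6]
    have h7 : (0 : ℝ) ≤ Int.log 2 M - Int.log 2 m := by exact_mod_cast h0
    nlinarith
  · rw [Int.toNat_of_nonpos h0]
    push_cast
    linarith

end Volume

/-! ### The padding parameter and the assembly of the coordinates -/

section Delta

variable {X : Type*} [MetricSpace X] {ε : X → ℤ → ℝ}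

theorem delta_le (hε : ∀ x u, 0 ≤ ε x u) {x y : X} {u : ℤ} (h1 : dist x y / 32 ≤ 2 ^ u)
    (h2 : (2 : ℝ) ^ u ≤ dist x y / 2) : delta ε x y ≤ ε x u :=
  csInf_le ⟨0, by rintro _ ⟨v, -, -, rfl⟩; exact hε x v⟩ ⟨u, h1, h2, rfl⟩

theorem delta_nonneg (hε : ∀ x u, 0 ≤ ε x u) (x y : X) : 0 ≤ delta ε x y :=
  Real.sInf_nonneg (by rintro _ ⟨v, -, -, rfl⟩; exact hε x v)

end Delta

/-- At each dyadic level `t` between the volumes of a small and a large ball about `x`, one of the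
eleven shifts of `volScale` separates `x` from `y` with constant probability. -/
theorem exists_shift_pow_le_sum_weight {X : Type*} [MetricSpace X] [Finite X] [MeasurableSpace X]
    [Fintype (Setoid X)] [Fintype (Set X)] {μ : Measure X} [IsFiniteMeasure μ] {ε : X → ℤ → ℝ}
    {β : ℤ → PMF (Setoid X)} (hβ : IsDecompositionBundle ε β) {x y : X} (hxy : x ≠ y) {t : ℤ}
    (hta : μ.real (Metric.ball x (dist x y / 512)) < 2 ^ t)
    (htb : 2 ^ t ≤ μ.real (Metric.ball x (2 * dist x y))) {η : ℝ} (hη : 0 ≤ η)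
    (hηδ : η ≤ delta ε x y) :
    ∃ i ∈ Finset.Icc (-4 : ℤ) 6, ∀ (S : Finset ℤ) (s : X → S),
      (∀ z, (s z : ℤ) = volScale μ z t + i) →
      ∀ [DecidablePred fun ω : S → Setoid X × (Set X → Bool) => η / 2048 * dist x y ≤
          |Metric.infDist x (colourSet s ω) - Metric.infDist y (colourSet s ω)|],
        (1 / 4096 : ℝ) ≤ ∑ ω : S → Setoid X × (Set X → Bool) with η / 2048 * dist x y ≤
          |Metric.infDist x (colourSet s ω) - Metric.infDist y (colourSet s ω)|, weight β ω := by
  have hd := dist_pos.2 hxy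
  set d := dist x y with hd'
  have hε (x : X) (u : ℤ) : 0 ≤ ε x u := (hβ.mem_Ioc x u).1.le
  obtain ⟨h1, h2, h3⟩ := volScale_spec (by positivity) hta htb
  set κ := volScale μ x t with hκ
  have h4 := Int.zpow_log_le_self (b := 2) (by norm_num) (by positivity : 0 < d / 8)
  have h5 := Int.lt_zpow_succ_log_self (b := 2) (by norm_num) (d / 8)
  -- The choice `d / 16 < 2 ^ u ≤ d / 8` keeps the scales `u - 1`, `u`, `u + 1` inside the window
  -- `[d / 32, d / 2]` that defines `delta`.
  set u := Int.log 2 (d / 8) with hu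
  rw [zpow_add_one₀ (by norm_num)] at h5
  push_cast at h4 h5
  have hv (l : ℤ) (hl : |l - u| ≤ 1) : d / 32 ≤ (2 : ℝ) ^ l ∧ (2 : ℝ) ^ l ≤ d / 2 := by
    rw [abs_le] at hl
    have h6 : (2 : ℝ) ^ (u - 1) ≤ 2 ^ l := zpow_le_zpow_right₀ (by norm_num) (by omega)
    have h7 : (2 : ℝ) ^ l ≤ 2 ^ (u + 1) := zpow_le_zpow_right₀ (by norm_num) (by omega)
    rw [zpow_sub_one₀ (by norm_num)] at h6
    rw [zpow_add_one₀ (by norm_num)] at h7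
    constructor <;> linarith
  have hη1 : η ≤ 1 := by
    have h8 := hv u (by simp)
    exact hηδ.trans ((delta_le hε h8.1 h8.2).trans (hβ.mem_Ioc x u).2)
  have hηd : η * d ≤ d := mul_le_of_le_one_left hd.le hη1
  -- This shift moves the scale of `x` to `u`. Since `d / 1024 < 2 ^ κ < 2 * d`, it lies between -4
  -- and 6.
  refine ⟨u - κ, ?_, fun S s hs _ => ?_⟩
  · have h6 : (2 : ℝ) ^ u < 2 ^ (κ + 7) := by
      rw [zpow_add₀ (by norm_num)]
      norm_num
      linarith
    have h7 : (2 : ℝ) ^ κ < 2 ^ (u + 5) := by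
      rw [zpow_add₀ (by norm_num)]
      norm_num
      linarith
    rw [zpow_lt_zpow_iff_right₀ (by norm_num)] at h6 h7
    rw [Finset.mem_Icc]
    omega
  · refine pow_le_sum_weight hβ s x y u (fun z hz => ?_) fun l hl => ?_
    · have h9 := h3 z (by
        refine hz.le.trans ?_
        linarith)
      rw [hs, show volScale μ z t + (u - κ) - u = volScale μ z t - κ by ring]
      exact h9
    · obtain ⟨h8, h9⟩ := hv l hl
      have h10 := hηδ.trans (delta_le hε h8 h9)
      refine ⟨?_, by linarith⟩
      calc η / 2048 * d ≤ η * (d / 32) := by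
            have := mul_nonneg hη hd.le
            linarith
        _ ≤ ε x l * 2 ^ l := mul_le_mul h10 h8 (by positivity) (hε x l)

/-- Distinct levels occupy disjoint blocks of coordinates, so their contributions add up. The good
shift may vary with `t`; its block is bounded below by that one summand. -/
theorem card_mul_le_sum_product {T I Ω : Type*} [Fintype T] [Fintype I] [Fintype Ω] (q : Ω → ℝ)
    (hq : ∀ ω, 0 ≤ q ω) (G : T × I × Ω → Prop) [DecidablePred G] (A : Finset T) (c : ℝ)
    (h : ∀ t ∈ A, ∃ i, c ≤ ∑ ω with G (t, i, ω), q ω) :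
    A.card * c ≤ ∑ j with G j, q j.2.2 := by
  rw [Finset.sum_filter, Fintype.sum_prod_type, ← nsmul_eq_mul]
  refine (Finset.card_nsmul_le_sum A _ c fun t ht => ?_).trans
    (Finset.sum_le_univ_sum_of_nonneg fun t => Finset.sum_nonneg fun j _ => ?_)
  · obtain ⟨i, hi⟩ := h t ht
    rw [Fintype.sum_prod_type]
    rw [Finset.sum_filter] at hi
    refine hi.trans (Finset.single_le_sum
      (f := fun i => ∑ ω, if G (t, i, ω) then q ω else 0)
      (fun i _ => Finset.sum_nonneg fun ω _ => ?_) (Finset.mem_univ i))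
    split_ifs
    exacts [hq _, le_rfl]
  · split_ifs
    exacts [hq _, le_rfl]

/-- The coordinates of the measured descent embedding, with nonnegative weights. -/
theorem exists_weighted_separating_family {X : Type*} [MetricSpace X] [Finite X]
    [MeasurableSpace X] [MeasurableSingletonClass X] {μ : Measure X} [IsFiniteMeasure μ]
    (hμ : NonDegenerate μ) {ε : X → ℤ → ℝ} {β : ℤ → PMF (Setoid X)}
    (hβ : IsDecompositionBundle ε β) (hX : ∃ x y : X, x ≠ y) :
    ∃ (n : ℕ) (q : Fin n → ℝ) (f : X → Fin n → ℝ), (∀ j, 0 ≤ q j) ∧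
      (∀ x y j, |f x j - f y j| ≤ dist x y) ∧
      ∑ j, q j ≤ 44 * Real.log (aspectRatio μ) ∧
      ∀ x y, x ≠ y → volGrowth μ x y / 8192 ≤
        ∑ j with min (delta ε x y) (delta ε y x) / 2048 * dist x y ≤ |f x j - f y j|, q j := by
  classical
  obtain ⟨x₀, y₀, hxy₀⟩ := hX
  have := Fintype.ofFinite X
  have := Fintype.ofFinite (Set X)
  have : Finite (Setoid X) :=
    Finite.of_injective (fun P : Setoid X => fun x => cluster P x) fun P Q h => by
      ext x y
      have h1 := congrArg (fun s : Set X => x ∈ s) (congrFun h y)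
      exact iff_of_eq h1
  have := Fintype.ofFinite (Setoid X)
  set M := μ.real Set.univ with hM
  set Φ := aspectRatio μ with hΦ
  have hΦ2 : 2 ≤ Φ := two_le_aspectRatio hμ hxy₀
  have hpt (z : X) : 0 < μ.real {z} := ENNReal.toReal_pos (hμ z).ne' (measure_ne_top _ _)
  have hM0 : 0 < M := (hpt x₀).trans_le (measureReal_mono (Set.subset_univ _))
  have hm (z : X) : M / Φ ≤ μ.real {z} := by
    rw [div_le_iff₀ (by positivity), mul_comm, ← div_le_iff₀ (hpt z)]
    exact div_le_aspectRatio z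
  -- Every nonempty ball has mass between `M / Φ` and `M`, so `T` contains all levels needed for any
  -- pair.
  let T : Finset ℤ := Finset.Ioc (Int.log 2 (M / Φ)) (Int.log 2 M)
  let I : Finset ℤ := Finset.Icc (-4) 6
  let S : Finset ℤ :=
    Finset.univ.image fun a : X × T × I => volScale μ a.1 (a.2.1 : ℤ) + (a.2.2 : ℤ)
  let s (t : T) (i : I) (z : X) : S :=
    ⟨volScale μ z (t : ℤ) + (i : ℤ), Finset.mem_image.2 ⟨(z, t, i), Finset.mem_univ _, rfl⟩⟩
  let Ω := S → Setoid X × (Set X → Bool)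
  let q (j : T × I × Ω) : ℝ := weight β j.2.2
  let f (x : X) (j : T × I × Ω) : ℝ := Metric.infDist x (colourSet (s j.1 j.2.1) j.2.2)
  have hside : ∀ x y : X, x ≠ y → ∀ η, 0 ≤ η → η ≤ delta ε x y → ∀ v : ℝ,
      v = Real.log (μ.real (Metric.ball x (2 * dist x y)) /
        μ.real (Metric.ball x (dist x y / 512))) → Real.log 2 ≤ v →
      v / 8192 ≤ ∑ j with η / 2048 * dist x y ≤ |f x j - f y j|, q j := by
    rintro x y hxy η hη hηδ v hv hlog
    have hd := dist_pos.2 hxy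
    have hball {r : ℝ} (hr : 0 < r) : μ.real {x} ≤ μ.real (Metric.ball x r) :=
      measureReal_mono (Set.singleton_subset_iff.2 (Metric.mem_ball_self hr))
    set a := μ.real (Metric.ball x (dist x y / 512)) with ha
    set b := μ.real (Metric.ball x (2 * dist x y)) with hb
    have ha0 : 0 < a := (hpt x).trans_le (hball (by positivity))
    have hb0 : 0 < b := (hpt x).trans_le (hball (by positivity))
    have hbM : b ≤ M := measureReal_mono (Set.subset_univ _)
    have hma : M / Φ ≤ a := (hm x).trans (hball (by positivity))
    let A : Finset T := Finset.univ.filter fun t => (t : ℤ) ∈ Finset.Ioc (Int.log 2 a) (Int.log 2 b)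
    have hA : A.card = (Finset.Ioc (Int.log 2 a) (Int.log 2 b)).card := by
      refine Finset.card_bij (fun t _ => (t : ℤ)) (fun t ht => (Finset.mem_filter.1 ht).2)
        (fun _ _ _ _ h => Subtype.ext h) fun t ht => ?_
      have ht' := Finset.mem_Ioc.1 ht
      refine ⟨⟨t, Finset.mem_Ioc.2 ⟨?_, ?_⟩⟩, Finset.mem_filter.2 ⟨Finset.mem_univ _, ht⟩, rfl⟩
      · exact (Int.log_mono_right (by positivity) hma).trans_lt ht'.1
      · exact ht'.2.trans (Int.log_mono_right hb0 hbM)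
    have h1 := half_log_div_le_card ha0 hb0 (hv ▸ hlog)
    rw [← hv, ← hA] at h1
    have h2 := card_mul_le_sum_product (weight β) (weight_nonneg β)
      (fun j : T × I × Ω => η / 2048 * dist x y ≤ |f x j - f y j|) A (1 / 4096) (by
        intro t ht
        have ht' := Finset.mem_Ioc.1 (Finset.mem_filter.1 ht).2
        obtain ⟨i, hi, H⟩ := exists_shift_pow_le_sum_weight (t := (t : ℤ)) hβ hxy
          (by simpa using (Int.lt_zpow_iff_log_lt (b := 2) (by norm_num) ha0).2 ht'.1)
          (by simpa using (Int.zpow_le_iff_le_log (b := 2) (by norm_num) hb0).2 ht'.2) hη hηδ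
        exact ⟨⟨i, hi⟩, H S (s t ⟨i, hi⟩) fun z => rfl⟩)
    -- At least `v / 2` levels contribute `1 / 4096` each.
    linarith
  -- Eleven shifts for each of at most `4 * log Φ` levels, each pair `(t, i)` having total
  -- probability 1.
  have hqsum : ∑ j, q j ≤ 44 * Real.log Φ := by
    have h1 : ∑ j, q j = (T.card : ℝ) * 11 := by
      have h2 : ∑ j, q j = ∑ _t : T, ∑ _i : I, ∑ ω : Ω, weight β ω := by
        simp only [Fintype.sum_prod_type]
        rfl
      rw [h2, sum_weight]
      simp [I]
    have h2 : M / (M / Φ) = Φ := by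
      field_simp
    have h3 := card_Ioc_log_le (m := M / Φ) (M := M) (by positivity) (by rw [h2]; exact hΦ2)
    rw [h2] at h3
    rw [h1]
    linarith
  let e := Fintype.equivFin (T × I × Ω)
  refine ⟨_, fun j => q (e.symm j), fun x j => f x (e.symm j), fun j => weight_nonneg β _,
    fun x y j => ?_, ?_, fun x y hxy => ?_⟩
  · rw [abs_le]
    have h1 := Metric.infDist_le_infDist_add_dist (s := colourSet (s (e.symm j).1 (e.symm j).2.1)
      (e.symm j).2.2) (x := x) (y := y)
    have h2 := Metric.infDist_le_infDist_add_dist (s := colourSet (s (e.symm j).1 (e.symm j).2.1)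
      (e.symm j).2.2) (x := y) (y := x)
    rw [dist_comm y x] at h2
    constructor <;> simp only [f] <;> linarith
  · rw [e.symm.sum_comp q]
    exact hqsum
  · have hlog := log_two_le_volGrowth hμ hxy
    have hε (x : X) (u : ℤ) : 0 ≤ ε x u := (hβ.mem_Ioc x u).1.le
    have hη := le_min (delta_nonneg hε x y) (delta_nonneg hε y x)
    set η := min (delta ε x y) (delta ε y x)
    rw [Finset.sum_filter, e.symm.sum_comp
      (fun j => if η / 2048 * dist x y ≤ |f x j - f y j| then q j else 0), ← Finset.sum_filter]
    -- The descent is run from the endpoint where the volume growth is attained; the minimum of the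
    -- two `delta` values serves either choice.
    rcases max_choice
      (Real.log (μ.real (Metric.ball x (2 * dist x y)) / μ.real (Metric.ball x (dist x y / 512))))
      (Real.log (μ.real (Metric.ball y (2 * dist x y)) / μ.real (Metric.ball y (dist x y / 512))))
      with h | h
    · exact hside x y hxy η hη (min_le_left _ _) _ h hlog
    · have h3 := hside y x hxy.symm η hη (min_le_right _ _) (volGrowth μ x y)
        (by rw [dist_comm y x]; exact h) hlog
      simp only [dist_comm y x, abs_sub_comm (f y _)] at h3
      exact h3

/-- The weights must be strictly positive, so outcomes of probability zero are discarded; the sums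
do not change. -/
theorem sum_subtype_pos {J : Type*} [Fintype J] (q F : J → ℝ) [DecidablePred fun j => 0 < q j]
    (hF : ∀ j, F j ≠ 0 → 0 < q j) : ∑ j : {j // 0 < q j}, F j = ∑ j, F j := by
  rw [← Finset.sum_subtype (Finset.univ.filter fun j => 0 < q j) (by simp) F]
  exact Finset.sum_filter_of_ne fun j _ => hF j

end MeasuredDescent

open MeasuredDescent in
theorem mainTheorem5 :
    ∃ C : ℝ, 0 < C ∧
      ∀ (X : Type*) [MetricSpace X] [Finite X] [MeasurableSpace X] [MeasurableSingletonClass X]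
        (μ : MeasureTheory.Measure X) [MeasureTheory.IsFiniteMeasure μ],
        MeasuredDescent.NonDegenerate μ →
        ∀ (ε : X → ℤ → ℝ) (β : ℤ → PMF (Setoid X)),
          MeasuredDescent.IsDecompositionBundle ε β →
          ∃ (ψ : X → ℕ →₀ ℝ) (w : ℕ → ℝ), (∀ i, 0 < w i) ∧
            ∀ p : ℝ≥0∞, 1 ≤ p →
              ∃ φ : X → ℕ →₀ ℝ, (∀ x i, φ x i = w i ^ (p⁻¹).toReal * ψ x i) ∧
                ∀ x y : X, x ≠ y →
                  MeasuredDescent.volGrowth μ x y ^ (p⁻¹).toReal *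
                      min (MeasuredDescent.delta ε x y) (MeasuredDescent.delta ε y x) ≤
                    MeasuredDescent.normP p (φ x - φ y) / dist x y ∧
                  MeasuredDescent.normP p (φ x - φ y) / dist x y ≤
                    C * Real.log (MeasuredDescent.aspectRatio μ) ^ (p⁻¹).toReal := by
  -- Total weight constant 44, and `c = 1 / 8192` from the separation estimate, entering as `1 / c ^
  -- 2`.
  refine ⟨44 / (1 / 8192) ^ 2, by positivity, fun X _ _ _ _ μ _ hμ ε β hβ => ?_⟩
  by_cases hX : ∃ x y : X, x ≠ y
  swap
  · push Not at hX
    exact ⟨0, 1, fun _ => one_pos, fun p _ => ⟨0, fun x i => by simp,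
      fun x y hxy => absurd (hX x y) hxy⟩⟩
  classical
  obtain ⟨n, q, f, hq, hf, hqL, hsep⟩ := exists_weighted_separating_family hμ hβ hX
  have hε (x : X) (u : ℤ) : 0 ≤ ε x u := (hβ.mem_Ioc x u).1.le
  have hpos {j : Fin n} (h : q j ≠ 0) : 0 < q j := lt_of_le_of_ne (hq j) h.symm
  refine exists_embedding_of_weights (J := {j // 0 < q j}) (fun j => q j) (fun j => j.2)
    (fun x j => f x j) (volGrowth μ) (fun x y => min (delta ε x y) (delta ε y x)) _ 44 (1 / 8192)
    (by norm_num) (by norm_num) (by norm_num) ?_ (fun x y j => hf x y j) ?_ ?_ ?_ ?_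
  · obtain ⟨x, y, hxy⟩ := hX
    exact Real.log_nonneg (one_le_two.trans (two_le_aspectRatio hμ hxy))
  · rw [sum_subtype_pos q q fun j => hpos]
    exact hqL
  · intro x y hxy
    exact (Real.log_pos one_lt_two).trans_le (log_two_le_volGrowth hμ hxy)
  · intro x y _
    exact le_min (delta_nonneg hε x y) (delta_nonneg hε y x)
  · intro x y hxy
    have hη := le_min (delta_nonneg hε x y) (delta_nonneg hε y x)
    have hd := (dist_pos.2 hxy).le
    rw [Finset.sum_filter, sum_subtype_pos q fun j =>
      if 1 / 8192 * min (delta ε x y) (delta ε y x) * dist x y ≤ |f x j - f y j| then q j else 0]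
    · rw [← Finset.sum_filter, one_div_mul_eq_div]
      refine (hsep x y hxy).trans (Finset.sum_le_sum_of_subset_of_nonneg (fun j hj => ?_)
        fun j _ _ => hq j)
      -- The family separates at the larger threshold `1 / 2048`; it is lowered because one `c`
      -- serves both threshold and mass.
      refine Finset.mem_filter.2 ⟨Finset.mem_univ j, le_trans ?_ (Finset.mem_filter.1 hj).2⟩
      refine mul_le_mul_of_nonneg_right ?_ hd
      linarith
    · intro j hj
      by_contra h
      refine hj ?_
      have h0 : q j = 0 := le_antisymm (not_lt.1 h) (hq j)
      simp [h0]
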